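/- For a field $\mathbb{F}$ and $k\ge 2$, a $k$-tensor over $\mathbb{F}$ is a $k$-linear form $T\colon(\mathbb{F}^n)^k\to\mathbb{F}$ (for some $n$). If $\mathbb{F}$ is finite, its analytic rank is $\mathrm{AR}(T)=-\log_{|\mathbb{F}|}\mathrm{bias}(T)$, where $\mathrm{bias}(T)=\Pr_{\mathbf x}[T(\mathbf x)=0]-\Pr_{\mathbf x}[T(\mathbf x)=y]$ for uniformly random $\mathbf x$ and any nonzero $y\in\mathbb{F}$ (the choice of $y$ does not matter). Put $d=k-1$ and $V=\mathbb{F}^n$, and identify $T$ with the $d$-linear map $V^d\to V$, $\mathbf x\mapsto(T(\mathbf x,e_1),\dots,T(\mathbf x,e_n))$. For $\mathbf p,\mathbf x\in V^d$ let $\mathbf p\circ_i\mathbf x=(p_1,\dots,p_i,x_{i+1},\dots,x_d)$. Write $\mathbf p\dashv_T\mathbf x$ if $T(\mathbf p\circ_i\mathbf x)=0$ for all $1\le i\le d-1$. For $1\le i\le d$ let $r_i(\mathbf p,\mathbf x)$ be the rank of the linear map $V\to V$, $v\mapsto T(p_1,\dots,p_{i-1},v,x_{i+1},\dots,x_d)$.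 The local rank of $T$ at $\mathbf p$ is $$\mathrm{LR}_{\mathbf p}(T)=\max_{\mathbf x\in V^d:\ \mathbf p\dashv_T\mathbf x}\big(r_1(\mathbf p,\mathbf x),\dots,r_d(\mathbf p,\mathbf x)\big)\in\mathbb{N}^d,$$ where the maximum is with respect to the colexicographic order on $\mathbb{N}^d$ (compare last coordinates first). The algebraic local rank $\overline{\mathrm{LR}}_{\mathbf p}(T)$ is the local rank at $\mathbf p$ of $T$ viewed as a tensor over the algebraic closure $\overline{\mathbb{F}}$. The point $\mathbf p\in V^d$ is LR-stable for $T$ if $\mathrm{LR}_{\mathbf p}(T)=\overline{\mathrm{LR}}_{\mathbf p}(T)$. For $\mathbf r\in\mathbb{N}^d$ let $\|\mathbf r\|=\sum_{i=1}^d 2^{d-i}r_i$. **Theorem (LR vs. AR).** For every $k\ge 2$ there is $C_k>0$ such that, for every $\varepsilon\in(0,1]$ and every $k$-tensor $T$ over a finite field $\mathbb{F}$ with $|\mathbb{F}|\ge C_k(\mathrm{AR}(T)+1)^{k-2}/\varepsilon$, there is an LR-stable point $\mathbf p\in(\mathbb{F}^n)^{k-1}$ for $T$ with $$\|\mathrm{LR}_{\mathbf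 p}(T)\|\le(2^{k-1}-1+\varepsilon)\,\mathrm{AR}(T).$$ -/

import Mathlib

namespace LocalRank

/-- A `k`-tensor over `K`: a `k`-linear form on `K ^ n`. -/
abbrev TensorForm (K : Type*) [Field K] (n k : ℕ) : Type _ :=
  MultilinearMap K (fun _ : Fin k => Fin n → K) K

/-- A `d`-linear map `V ^ d → V`, where `V = K ^ n`. -/
abbrev TensorMap (K : Type*) [Field K] (n d : ℕ) : Type _ :=
  MultilinearMap K (fun _ : Fin d => Fin n → K) (Fin n → K)

/-- The bias of a `k`-tensor over a finite field, `Pr_x[T x = 0] - Pr_x[T x = 1]` with `x`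
uniformly random. The value `1` may be replaced by any nonzero `y`, see `card_fiber_eq`. -/
noncomputable def bias {K : Type*} [Field K] {n k : ℕ} (T : TensorForm K n k) : ℝ :=
  ((Nat.card {x : Fin k → Fin n → K // T x = 0} : ℝ)
      - (Nat.card {x : Fin k → Fin n → K // T x = 1} : ℝ))
    / (Nat.card (Fin k → Fin n → K) : ℝ)

/-- All nonzero values are taken equally often, so `bias` does not depend on the value chosen. -/
theorem card_fiber_eq {K : Type*} [Field K] {n k : ℕ} (T : TensorForm K n (k + 1)) {y : K}
    (hy : y ≠ 0) :
    Nat.card {x : Fin (k + 1) → Fin n → K // T x = y}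
      = Nat.card {x : Fin (k + 1) → Fin n → K // T x = 1} := by
  have key : ∀ (c : K) (x : Fin (k + 1) → Fin n → K),
      T (Function.update x 0 (c • x 0)) = c * T x := by
    intro c x
    rw [T.map_update_smul, Function.update_eq_self, smul_eq_mul]
  refine Nat.card_congr
    { toFun := fun x => ⟨Function.update x.1 0 (y⁻¹ • x.1 0), by
        rw [key, x.2, inv_mul_cancel₀ hy]⟩
      invFun := fun x => ⟨Function.update x.1 0 (y • x.1 0), by
        rw [key, x.2, mul_one]⟩
      left_inv := ?_
      right_inv := ?_ }
  · rintro ⟨x, hx⟩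
    simp [smul_smul, hy]
  · rintro ⟨x, hx⟩
    simp [smul_smul, hy]

/-- The analytic rank `AR(T) = - log_{|K|} bias(T)` of a `k`-tensor over a finite field. -/
noncomputable def analyticRank {K : Type*} [Field K] {n k : ℕ} (T : TensorForm K n k) : ℝ :=
  -Real.logb (Nat.card K) (bias T)

/-- The `d`-linear map `x ↦ (T (x, e₁), …, T (x, eₙ))` attached to a `(d + 1)`-tensor `T`. -/
noncomputable def toMap {K : Type*} [Field K] {n d : ℕ} (T : TensorForm K n (d + 1)) :
    TensorMap K n d :=
  (LinearMap.pi fun j : Fin n =>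
      (LinearMap.applyₗ (Pi.single j (1 : K)) :
        ((Fin n → K) →ₗ[K] K) →ₗ[K] K)).compMultilinearMap T.curryRight

theorem toMap_apply {K : Type*} [Field K] {n d : ℕ} (T : TensorForm K n (d + 1))
    (x : Fin d → Fin n → K) (j : Fin n) :
    toMap T x j = T (Fin.snoc x (Pi.single j 1)) := rfl

/-- `(x₁, …, xᵢ, yᵢ₊₁, …, y_d)`. -/
def splice {V : Type*} {d : ℕ} (i : ℕ) (x y : Fin d → V) : Fin d → V :=
  fun j => if (j : ℕ) < i then x j else y j

/-- `(p, x)` is an adjoint pair of `T`: `T (p₁, …, pᵢ, xᵢ₊₁, …, x_d) = 0` for `1 ≤ i ≤ d - 1`. -/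
def IsAdjoint {K : Type*} [Field K] {n d : ℕ} (T : TensorMap K n d)
    (p x : Fin d → Fin n → K) : Prop :=
  ∀ i : ℕ, 1 ≤ i → i < d → T (splice i p x) = 0

/-- The tuple of the ranks of the matrix slices
`v ↦ T (p₁, …, pᵢ₋₁, v, xᵢ₊₁, …, x_d)`, `1 ≤ i ≤ d` (the index `i : Fin d` is shifted by one),
as an element of `ℕ ^ d` with the colexicographic order. -/
noncomputable def rankTuple {K : Type*} [Field K] {n d : ℕ} (T : TensorMap K n d)
    (p x : Fin d → Fin n → K) : Colex (Fin d → ℕ) :=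
  toColex fun i : Fin d =>
    Module.finrank K (LinearMap.range (T.toLinearMap (splice ((i : ℕ) + 1) p x) i))

/-- The rank tuples of all walks at `p`. -/
def rankTuples {K : Type*} [Field K] {n d : ℕ} (T : TensorMap K n d)
    (p : Fin d → Fin n → K) : Set (Colex (Fin d → ℕ)) :=
  {r | ∃ x : Fin d → Fin n → K, IsAdjoint T p x ∧ r = rankTuple T p x}

theorem isAdjoint_zero {K : Type*} [Field K] {n d : ℕ} (T : TensorMap K n d)
    (p : Fin d → Fin n → K) : IsAdjoint T p 0 := by
  intro i _ hid
  refine T.map_coord_zero (⟨d - 1, by omega⟩ : Fin d) ?_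
  have : ¬ (d - 1 < i) := by omega
  simp [splice, this]

theorem rankTuples_nonempty {K : Type*} [Field K] {n d : ℕ} (T : TensorMap K n d)
    (p : Fin d → Fin n → K) : (rankTuples T p).Nonempty :=
  ⟨_, 0, isAdjoint_zero T p, rfl⟩

theorem rankTuples_finite {K : Type*} [Field K] {n d : ℕ} (T : TensorMap K n d)
    (p : Fin d → Fin n → K) : (rankTuples T p).Finite := by
  have hfin : (Set.Iic (fun _ : Fin d => n)).Finite := Set.finite_Iic _
  refine (hfin.image toColex).subset ?_
  rintro r ⟨x, _, rfl⟩
  refine ⟨_, fun i => ?_, rfl⟩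
  exact (Submodule.finrank_le _).trans (by simp)

theorem exists_isGreatest_rankTuples {K : Type*} [Field K] {n d : ℕ} (T : TensorMap K n d)
    (p : Fin d → Fin n → K) : ∃ r, IsGreatest (rankTuples T p) r := by
  obtain ⟨r, hr, hmax⟩ := (rankTuples_finite T p).exists_maximal (rankTuples_nonempty T p)
  exact ⟨r, hr, fun s hs => (le_total s r).elim id (hmax hs)⟩

/-- The local rank of `T` at `p`: the colexicographic maximum of the rank tuples over all `x`
such that `(p, x)` is an adjoint pair of `T`. -/
noncomputable def localRank {K : Type*} [Field K] {n d : ℕ} (T : TensorMap K n d)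
    (p : Fin d → Fin n → K) : Colex (Fin d → ℕ) :=
  (exists_isGreatest_rankTuples T p).choose

theorem isGreatest_localRank {K : Type*} [Field K] {n d : ℕ} (T : TensorMap K n d)
    (p : Fin d → Fin n → K) : IsGreatest (rankTuples T p) (localRank T p) :=
  (exists_isGreatest_rankTuples T p).choose_spec

/-- `T` viewed as a `d`-linear map over an extension field `L`: the `d`-linear map on `L ^ n` with
the same coefficients. By `extend_algebraMap` it extends `T`, and as an `L`-multilinear map is
determined by its values on the standard basis, it is the only extension. -/
noncomputable def extend {K : Type*} [Field K] (L : Type*) [Field L] [Algebra K L] {n d : ℕ}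
    (T : TensorMap K n d) : TensorMap L n d :=
  ∑ σ : Fin d → Fin n,
    ((MultilinearMap.mkPiAlgebra L (Fin d) L).compLinearMap fun i =>
      (LinearMap.proj (σ i) : (Fin n → L) →ₗ[L] L)).smulRight
        (fun j => algebraMap K L (T (fun i => Pi.single (σ i) 1) j))

theorem extend_apply {K : Type*} [Field K] (L : Type*) [Field L] [Algebra K L] {n d : ℕ}
    (T : TensorMap K n d) (x : Fin d → Fin n → L) (j : Fin n) :
    extend L T x j
      = ∑ σ : Fin d → Fin n,
          (∏ i, x i (σ i)) * algebraMap K L (T (fun i => Pi.single (σ i) 1) j) := by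
  simp [extend, Finset.sum_apply]

theorem extend_algebraMap {K : Type*} [Field K] (L : Type*) [Field L] [Algebra K L] {n d : ℕ}
    (T : TensorMap K n d) (x : Fin d → Fin n → K) (j : Fin n) :
    extend L T (fun i l => algebraMap K L (x i l)) j = algebraMap K L (T x j) := by
  have hx : x = fun i => ∑ l : Fin n, x i l • (Pi.single l (1 : K) : Fin n → K) := by
    funext i
    exact pi_eq_sum_univ' (x i)
  rw [extend_apply]
  conv_rhs => rw [hx, T.map_sum]
  simp only [T.map_smul_univ, Finset.sum_apply, Pi.smul_apply, smul_eq_mul, map_sum, map_mul,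
    map_prod]

/-- The algebraic local rank of `T` at `p`: the local rank over the algebraic closure. -/
noncomputable def algLocalRank {K : Type*} [Field K] {n d : ℕ} (T : TensorMap K n d)
    (p : Fin d → Fin n → K) : Colex (Fin d → ℕ) :=
  localRank (extend (AlgebraicClosure K) T)
    (fun i j => algebraMap K (AlgebraicClosure K) (p i j))

/-- `p` is LR-stable for `T` if local rank and algebraic local rank of `T` at `p` agree. -/
def IsLRStable {K : Type*} [Field K] {n d : ℕ} (T : TensorMap K n d)
    (p : Fin d → Fin n → K) : Prop :=
  localRank T p = algLocalRank T p

/-- The norm `‖(r₁, …, r_d)‖ = ∑ i, 2 ^ (d - i) * rᵢ` (the index `i : Fin d` is shifted by one). -/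
def weightedNorm {d : ℕ} (r : Colex (Fin d → ℕ)) : ℕ :=
  ∑ i : Fin d, 2 ^ (d - ((i : ℕ) + 1)) * ofColex r i

end LocalRank

/-! Let `q` be the size of the field, `V = K ^ n`, and `Z` the zero set of the `d`-linear map `T`.
Then the bias is `|Z| / |V ^ d|` (`bias_eq`). The sum over `Z` of `q ^ rank` of the slice in a fixed
direction is `|V ^ d|`, so by concavity of the logarithm the average rank over `Z` is at most the
analytic rank AR (`sum_rank_le`). Resampling one coordinate subject to `T = 0` preserves the uniform
measure on `Z` (`sum_resample`). Hence the rank reached by a random walk from a uniform point of `Z`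
also has mean at most AR, and some `p` makes the weighted sum of the expected ranks at most `(2 ^ d
- 1) AR` (`exists_sum_expRank_le`).

In the other direction, let `R` be the algebraic local rank at `p`, attained by a walk `x` over the
closure. Each slice along `x` has a nonzero minor of order `R i`. Cramer's rule with these minors
parametrizes walks at `p` by free seeds, and the product of the minors met is a polynomial over `K`
in the seeds, nonzero because some seeds over the closure reproduce `x`. If the ranks are at most
`N`, Schwartz-Zippel makes it vanish on a fraction at most `(N + 2) ^ m / q` of the seeds. Where it
does not vanish, the ranks equal `R i` one after another, since `R` is a colexicographic upper bound
over `K` too; and uniform seeds give uniform resampling. So the expected rank is almost `R j`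
(`mul_sub_le_expRank_mul`), and one nonvanishing seed already gives stability
(`isLRStable_of_pow_lt_card`). A bound `N` free of `n` comes from a bootstrap starting at the last
coordinate (`algLocalRank_le_of_expRank_le`). -/

namespace LocalRank

/-! ### Degrees of determinants and Cramer's rule -/

open MvPolynomial in
theorem totalDegree_det_le {σ R : Type*} [CommRing R] {s D : ℕ}
    (M : Matrix (Fin s) (Fin s) (MvPolynomial σ R)) (h : ∀ i j, (M i j).totalDegree ≤ D) :
    M.det.totalDegree ≤ s * D := by
  rw [Matrix.det_apply]
  refine totalDegree_finsetSum_le fun τ _ => ?_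
  have h1 : (∏ i, M (τ i) i).totalDegree ≤ s * D := by
    refine (totalDegree_finsetProd _ _).trans ?_
    refine (Finset.sum_le_sum fun i _ => h (τ i) i).trans ?_
    simp
  rcases Int.units_eq_one_or (Equiv.Perm.sign τ) with h2 | h2 <;> simpa [h2] using h1

open MvPolynomial in
theorem totalDegree_adjugate_le {σ R : Type*} [CommRing R] {s D : ℕ}
    (M : Matrix (Fin s) (Fin s) (MvPolynomial σ R)) (h : ∀ i j, (M i j).totalDegree ≤ D)
    (i j : Fin s) : (M.adjugate i j).totalDegree ≤ (s - 1) * D := by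
  cases s with
  | zero => exact i.elim0
  | succ s =>
    rw [Matrix.adjugate_fin_succ_eq_det_submatrix]
    refine (totalDegree_mul _ _).trans ?_
    have h1 : ((-1 : MvPolynomial σ R) ^ (j + i : ℕ)).totalDegree = 0 := by
      rcases neg_one_pow_eq_or (MvPolynomial σ R) (j + i : ℕ) with h2 | h2 <;> simp [h2]
    rw [h1, zero_add]
    exact totalDegree_det_le _ fun _ _ => h _ _

/-- The minor of `M` with rows `I` and columns `J`. -/
def minor {A : Type*} [CommRing A] {n s : ℕ} (M : Matrix (Fin n) (Fin n) A)
    (I J : Fin s → Fin n) : A :=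
  (M.submatrix I J).det

/-- Cramer's rule: a polynomial parametrization of the vectors killed by the rows `I` of `M`. -/
def cramerVec {A : Type*} [CommRing A] {n s : ℕ} (M : Matrix (Fin n) (Fin n) A)
    (I J : Fin s → Fin n) (z : Fin n → A) : Fin n → A :=
  fun b => minor M I J * z b
    - ∑ k, if J k = b then ∑ l, (M.submatrix I J).adjugate k l * ∑ c, M (I l) c * z c else 0

section Cramer

variable {A B : Type*} [CommRing A] [CommRing B] {n s : ℕ}

theorem map_minor (f : A →+* B) (M : Matrix (Fin n) (Fin n) A) (I J : Fin s → Fin n) :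
    f (minor M I J) = minor (M.map f) I J := by
  rw [minor, minor, RingHom.map_det]
  rfl

theorem map_cramerVec (f : A →+* B) (M : Matrix (Fin n) (Fin n) A) (I J : Fin s → Fin n)
    (z : Fin n → A) (b : Fin n) :
    f (cramerVec M I J z b) = cramerVec (M.map f) I J (fun c => f (z c)) b := by
  have h : ∀ k l, f ((M.submatrix I J).adjugate k l)
      = ((M.map f).submatrix I J).adjugate k l := by
    intro k l
    have := congrFun (congrFun (RingHom.map_adjugate f (M.submatrix I J)) k) l
    simpa [Matrix.submatrix_map] using this
  simp only [cramerVec, map_sub, map_mul, map_minor, map_sum, apply_ite f, map_zero, h,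
    Matrix.map_apply]

/-- The correction term solves the `I`-by-`J` subsystem through the adjugate, so no condition on the
minor is needed. -/
theorem mulVec_cramerVec_apply (M : Matrix (Fin n) (Fin n) A) (I J : Fin s → Fin n)
    (z : Fin n → A) (k : Fin s) : M.mulVec (cramerVec M I J z) (I k) = 0 := by
  have h1 : ∑ b, M (I k) b *
      (∑ k', if J k' = b then
        ∑ l, (M.submatrix I J).adjugate k' l * ∑ c, M (I l) c * z c else 0)
      = ∑ k', M (I k) (J k') *
        ∑ l, (M.submatrix I J).adjugate k' l * ∑ c, M (I l) c * z c := by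
    simp only [Finset.mul_sum (Finset.univ : Finset (Fin s)), mul_ite, mul_zero]
    rw [Finset.sum_comm]
    simp
  have h2 : ∑ k', M (I k) (J k') *
        ∑ l, (M.submatrix I J).adjugate k' l * ∑ c, M (I l) c * z c
      = minor M I J * ∑ c, M (I k) c * z c := by
    have h3 := congrArg (fun N : Matrix (Fin s) (Fin s) A =>
      N.mulVec (fun l => ∑ c, M (I l) c * z c) k) (Matrix.mul_adjugate (M.submatrix I J))
    simp only [← Matrix.mulVec_mulVec, Matrix.smul_mulVec, Matrix.one_mulVec, Pi.smul_apply,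
      smul_eq_mul] at h3
    exact h3
  simp only [Matrix.mulVec, dotProduct, cramerVec, mul_sub, Finset.sum_sub_distrib]
  rw [h1, h2, Finset.mul_sum, sub_eq_zero]
  exact Finset.sum_congr rfl fun c _ => by ring

/-- The correction vanishes on the kernel. Hence, over a field with nonzero minor, the
parametrization reaches every kernel vector. -/
theorem cramerVec_of_mulVec_eq_zero (M : Matrix (Fin n) (Fin n) A) (I J : Fin s → Fin n)
    {z : Fin n → A} (hz : M.mulVec z = 0) : cramerVec M I J z = minor M I J • z := by
  have h : ∀ l, ∑ c, M (I l) c * z c = 0 := fun l => congrFun hz (I l)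
  funext b
  simp [cramerVec, h]

theorem cramerVec_add (M : Matrix (Fin n) (Fin n) A) (I J : Fin s → Fin n)
    (y z : Fin n → A) : cramerVec M I J (y + z) = cramerVec M I J y + cramerVec M I J z := by
  funext b
  simp only [cramerVec, Pi.add_apply, mul_add, Finset.sum_add_distrib]
  have : ∀ k (x y : A), (if J k = b then x + y else 0)
    = (if J k = b then x else 0) + (if J k = b then y else 0) := by
    intro k x y; split_ifs <;> simp
  simp only [this, Finset.sum_add_distrib]
  ring

open MvPolynomial in
theorem totalDegree_minor_le {σ : Type*} {D : ℕ}
    (M : Matrix (Fin n) (Fin n) (MvPolynomial σ A)) (h : ∀ i j, (M i j).totalDegree ≤ D)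
    (I J : Fin s → Fin n) : (minor M I J).totalDegree ≤ s * D :=
  totalDegree_det_le _ fun _ _ => h _ _

open MvPolynomial in
theorem totalDegree_cramerVec_le {σ : Type*} {D : ℕ}
    (M : Matrix (Fin n) (Fin n) (MvPolynomial σ A)) (h : ∀ i j, (M i j).totalDegree ≤ D)
    (I J : Fin s → Fin n) (z : Fin n → MvPolynomial σ A) (hz : ∀ c, (z c).totalDegree ≤ 1)
    (b : Fin n) : (cramerVec M I J z b).totalDegree ≤ s * D + 1 := by
  refine (totalDegree_sub _ _).trans (max_le ?_ ?_)
  · exact (totalDegree_mul _ _).trans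
      (add_le_add (totalDegree_minor_le M h I J) (hz b))
  · refine totalDegree_finsetSum_le fun k _ => ?_
    split_ifs
    · refine totalDegree_finsetSum_le fun l _ => (totalDegree_mul _ _).trans ?_
      have h1 := totalDegree_adjugate_le (M.submatrix I J) (fun _ _ => h _ _) k l
      have h2 : (∑ c, M (I l) c * z c).totalDegree ≤ D + 1 :=
        totalDegree_finsetSum_le fun c _ => (totalDegree_mul _ _).trans
          (add_le_add (h _ _) (hz c))
      -- The truncated subtraction is harmless: the index `k : Fin s` forces `s` to be positive.
      have h3 : (s - 1) * D + D = s * D := by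
        obtain ⟨s', rfl⟩ : ∃ s', s = s' + 1 := ⟨s - 1, by have := k.2; omega⟩
        simp; ring
      omega
    · simp

end Cramer

/-! ### Rank and nonvanishing minors -/

section Rank

variable {L : Type*} [Field L] {n s : ℕ}

theorem le_rank_of_minor_ne_zero (M : Matrix (Fin n) (Fin n) L) {I J : Fin s → Fin n}
    (h : minor M I J ≠ 0) : s ≤ M.rank := by
  have h1 := Matrix.rank_of_det_ne_zero (A := M.submatrix I J) h
  rw [Fintype.card_fin] at h1
  exact h1 ▸ Matrix.rank_submatrix_le M I J

theorem exists_minor_ne_zero (M : Matrix (Fin n) (Fin n) L) (h : s ≤ M.rank) :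
    ∃ I J : Fin s → Fin n, minor M I J ≠ 0 := by
  have key : ∀ {m : ℕ} (N : Matrix (Fin m) (Fin n) L), s ≤ N.rank →
      ∃ J : Fin s → Fin n, LinearIndependent L (fun k => N.col (J k)) := by
    intro m N hN
    rw [Matrix.rank_eq_finrank_span_cols] at hN
    obtain ⟨f, hf, -, hli⟩ := Submodule.exists_fun_fin_finrank_span_eq L (Set.range N.col)
    choose g hg using hf
    refine ⟨fun k => g (Fin.castLE hN k), ?_⟩
    simp only [hg]
    exact hli.comp _ (Fin.castLE_injective hN)
  obtain ⟨J, hJ⟩ := key M h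
  have h2 : s ≤ (M.submatrix id J).transpose.rank := by
    have : LinearIndependent L (M.submatrix id J).transpose.row := hJ
    rw [this.rank_matrix, Fintype.card_fin]
  obtain ⟨I, hI⟩ := key _ h2
  refine ⟨I, J, ?_⟩
  have h3 : LinearIndependent L (M.submatrix I J).row := hI
  exact (Matrix.isUnit_iff_isUnit_det _).1
    (Matrix.linearIndependent_rows_iff_isUnit.1 h3) |>.ne_zero

/-- Projecting the column space to the rows `I` is onto because of the minor, hence injective by
equality of dimensions. -/
theorem mulVec_eq_zero_of_rank_le (M : Matrix (Fin n) (Fin n) L) {I J : Fin s → Fin n}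
    (h : minor M I J ≠ 0) (hr : M.rank ≤ s) {y : Fin n → L}
    (hy : ∀ k, M.mulVec y (I k) = 0) : M.mulVec y = 0 := by
  have hu : IsUnit (M.submatrix I J) := (Matrix.isUnit_iff_isUnit_det _).2 (Ne.isUnit h)
  let φ : LinearMap.range M.mulVecLin →ₗ[L] (Fin s → L) :=
    (LinearMap.funLeft L L I).comp (Submodule.subtype _)
  have hφ : Function.Surjective φ := by
    intro w
    obtain ⟨v, hv⟩ := (Matrix.mulVec_surjective_iff_isUnit.2 hu) w
    refine ⟨⟨_, ⟨∑ k, v k • Pi.single (J k) 1, rfl⟩⟩, ?_⟩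
    funext k
    rw [← hv]
    simp [φ, LinearMap.funLeft_apply, Matrix.mulVec,
      dotProduct, Finset.sum_apply, mul_comm]
  have hfin : Module.finrank L (LinearMap.range M.mulVecLin) = Module.finrank L (Fin s → L) := by
    rw [Module.finrank_fin_fun]
    exact le_antisymm hr (le_rank_of_minor_ne_zero M h)
  have hinj := (LinearMap.injective_iff_surjective_of_finrank_eq_finrank hfin).2 hφ
  have h0 : φ ⟨M.mulVec y, ⟨y, rfl⟩⟩ = φ 0 := by
    rw [map_zero]
    funext k
    exact hy k
  exact congrArg Subtype.val (hinj h0)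

theorem mulVec_cramerVec (M : Matrix (Fin n) (Fin n) L) {I J : Fin s → Fin n}
    (h : minor M I J ≠ 0) (hr : M.rank ≤ s) (z : Fin n → L) :
    M.mulVec (cramerVec M I J z) = 0 :=
  mulVec_eq_zero_of_rank_le M h hr (mulVec_cramerVec_apply M I J z)

theorem rank_map_eq {L' : Type*} [Field L'] (f : L →+* L') (M : Matrix (Fin n) (Fin n) L) :
    (M.map f).rank = M.rank := by
  have hm : ∀ {t : ℕ} (I J : Fin t → Fin n), minor (M.map f) I J ≠ 0 ↔ minor M I J ≠ 0 := by
    intro t I J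
    rw [← map_minor, Ne, map_eq_zero]
  apply le_antisymm
  · obtain ⟨I, J, h⟩ := exists_minor_ne_zero (M.map f) le_rfl
    exact le_rank_of_minor_ne_zero M ((hm I J).1 h)
  · obtain ⟨I, J, h⟩ := exists_minor_ne_zero M le_rfl
    exact le_rank_of_minor_ne_zero (M.map f) ((hm I J).2 h)

end Rank

/-- The coordinates of `T`, extended to points over a commutative `K`-algebra. -/
noncomputable def coeffMap {K A : Type*} [Field K] [CommRing A] [Algebra K A] {n d : ℕ}
    (T : TensorMap K n d) (x : Fin d → Fin n → A) (a : Fin n) : A :=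
  ∑ σ : Fin d → Fin n, (∏ i, x i (σ i)) * algebraMap K A (T (fun i => Pi.single (σ i) 1) a)

/-- The matrix of the slice of `T` at `u` in direction `i`, over a commutative `K`-algebra. -/
noncomputable def sliceMatrix {K A : Type*} [Field K] [CommRing A] [Algebra K A] {n d : ℕ}
    (T : TensorMap K n d) (i : Fin d) (u : Fin d → Fin n → A) : Matrix (Fin n) (Fin n) A :=
  fun a b => coeffMap T (Function.update u i (Pi.single b 1)) a

/-! ### Slices under change of base -/

section Slice

variable {K : Type*} [Field K] {n d : ℕ} (T : TensorMap K n d)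

theorem map_sliceMatrix {A B : Type*} [CommRing A] [Algebra K A] [CommRing B] [Algebra K B]
    (f : A →ₐ[K] B) (i : Fin d) (u : Fin d → Fin n → A) :
    (sliceMatrix T i u).map (f : A →+* B) = sliceMatrix T i (fun l c => f (u l c)) := by
  ext a b
  simp only [Matrix.map_apply, sliceMatrix, coeffMap, map_sum, map_mul, map_prod,
    RingHom.coe_coe, AlgHom.commutes]
  refine Finset.sum_congr rfl fun σ _ => ?_
  congr 1
  refine Finset.prod_congr rfl fun l _ => ?_
  by_cases hl : l = i
  · subst hl
    by_cases hb : σ l = b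
    · subst hb; simp
    · simp [hb]
  · simp [hl]

open MvPolynomial in
theorem totalDegree_sliceMatrix_le {σ : Type*} (i : Fin d)
    (u : Fin d → Fin n → MvPolynomial σ K) (e : Fin d → ℕ)
    (h : ∀ l c, (u l c).totalDegree ≤ e l) (a b : Fin n) :
    (sliceMatrix T i u a b).totalDegree ≤ ∑ l, e l := by
  refine totalDegree_finsetSum_le fun τ _ => (totalDegree_mul _ _).trans ?_
  rw [MvPolynomial.algebraMap_eq, totalDegree_C, add_zero]
  refine (totalDegree_finsetProd _ _).trans (Finset.sum_le_sum fun l _ => ?_)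
  by_cases hl : l = i
  · subst hl
    by_cases hb : τ l = b
    · subst hb; simp
    · simp [hb]
  · simpa [hl] using h l _

variable (L : Type*) [Field L] [Algebra K L]

theorem sliceMatrix_mulVec (i : Fin d) (u : Fin d → Fin n → L) (v : Fin n → L) :
    (sliceMatrix T i u).mulVec v = extend L T (Function.update u i v) := by
  have h : sliceMatrix T i u = LinearMap.toMatrix' ((extend L T).toLinearMap u i) := by
    ext a b
    rw [LinearMap.toMatrix'_apply, MultilinearMap.toLinearMap_apply, extend_apply]
    rfl
  rw [h, LinearMap.toMatrix'_mulVec, MultilinearMap.toLinearMap_apply]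

theorem rank_sliceMatrix (i : Fin d) (u : Fin d → Fin n → L) :
    (sliceMatrix T i u).rank
      = Module.finrank L (LinearMap.range ((extend L T).toLinearMap u i)) := by
  have : (sliceMatrix T i u).mulVecLin = (extend L T).toLinearMap u i := by
    refine LinearMap.ext fun v => ?_
    rw [Matrix.mulVecLin_apply, sliceMatrix_mulVec, MultilinearMap.toLinearMap_apply]
  rw [Matrix.rank, this]

theorem extend_self : extend K T = T :=
  MultilinearMap.ext fun x => funext fun j => extend_algebraMap K T x j

theorem sliceMatrix_mulVec_self (i : Fin d) (u : Fin d → Fin n → K) (v : Fin n → K) :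
    (sliceMatrix T i u).mulVec v = T (Function.update u i v) := by
  rw [sliceMatrix_mulVec, extend_self]

theorem rank_sliceMatrix_self (i : Fin d) (u : Fin d → Fin n → K) :
    (sliceMatrix T i u).rank = Module.finrank K (LinearMap.range (T.toLinearMap u i)) := by
  rw [rank_sliceMatrix, extend_self]

theorem splice_map {V W : Type*} (f : V → W) (i : ℕ) (p x : Fin d → V) :
    splice i (fun l => f (p l)) (fun l => f (x l)) = fun l => f (splice i p x l) := by
  funext l
  simp only [splice]
  split_ifs <;> rfl

theorem rankTuples_subset_extend (p : Fin d → Fin n → K) :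
    rankTuples T p ⊆ rankTuples (extend L T) (fun i c => algebraMap K L (p i c)) := by
  rintro r ⟨x, hx, rfl⟩
  refine ⟨fun i c => algebraMap K L (x i c), fun i h1 h2 => ?_, ?_⟩
  · rw [splice_map (fun (v : Fin n → K) c => algebraMap K L (v c))]
    funext a
    rw [extend_algebraMap, hx i h1 h2]
    simp
  · refine congrArg toColex (funext fun i => ?_)
    rw [← rank_sliceMatrix, splice_map (fun (v : Fin n → K) c => algebraMap K L (v c)),
      ← rank_sliceMatrix_self, ← rank_map_eq (algebraMap K L)]
    exact congrArg Matrix.rank (map_sliceMatrix T (Algebra.ofId K L) i _)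

end Slice

section Splice

variable {V : Type*} {d : ℕ}

theorem update_splice_succ (p x : Fin d → V) (i : Fin d) (v : V) :
    Function.update (splice ((i : ℕ) + 1) p x) i v = splice i p (Function.update x i v) := by
  funext l
  by_cases h : l = i
  · subst h; simp [splice]
  · have : (l : ℕ) ≠ i := fun h' => h (Fin.ext h')
    have h2 : (l : ℕ) < i + 1 ↔ (l : ℕ) < i := by omega
    simp [splice, h, h2]

theorem splice_update_of_lt (p x : Fin d → V) {i : Fin d} {l : ℕ} (h : (i : ℕ) < l) (v : V) :
    splice l p (Function.update x i v) = splice l p x := by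
  funext a
  by_cases ha : a = i
  · subst ha; simp [splice, h]
  · simp [splice, ha]

end Splice

/-- The parametrized walk that updates the coordinates `j + m, …, j + 1` of `u` in this order by
Cramer's rule with seeds `z`, and returns the product of the minors met on the way with the minor
of the slice in direction `j` at the end. -/
noncomputable def walkMinor {K A : Type*} [Field K] [CommRing A] [Algebra K A] {n d : ℕ}
    (T : TensorMap K n d) {s : Fin d → ℕ} (I J : ∀ i, Fin (s i) → Fin n) (j : ℕ) :
    ∀ m : ℕ, j + m < d → (Fin d → Fin n → A) → (Fin m → Fin n → A) → A
  | 0, h, u, _ => minor (sliceMatrix T ⟨j, h⟩ u) (I ⟨j, h⟩) (J ⟨j, h⟩)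
  | m + 1, h, u, z =>
      minor (sliceMatrix T ⟨j + (m + 1), h⟩ u) (I ⟨j + (m + 1), h⟩) (J ⟨j + (m + 1), h⟩)
        * walkMinor T I J j m (by omega)
            (Function.update u ⟨j + (m + 1), h⟩
              (cramerVec (sliceMatrix T ⟨j + (m + 1), h⟩ u)
                (I ⟨j + (m + 1), h⟩) (J ⟨j + (m + 1), h⟩) (z 0)))
            (fun k => z k.succ)

/-! ### The minor polynomial of a parametrized walk -/

section WalkMinor

variable {K : Type*} [Field K] {n d : ℕ} (T : TensorMap K n d) {s : Fin d → ℕ}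
  (I J : ∀ i, Fin (s i) → Fin n)

/-- Specializes one polynomial in the seeds both to points over `K` and to points over the closure.
-/
theorem map_walkMinor {A B : Type*} [CommRing A] [Algebra K A] [CommRing B] [Algebra K B]
    (f : A →ₐ[K] B) (j m : ℕ) (h : j + m < d) (u : Fin d → Fin n → A) (z : Fin m → Fin n → A) :
    f (walkMinor T I J j m h u z)
      = walkMinor T I J j m h (fun l c => f (u l c)) (fun k c => f (z k c)) := by
  induction m generalizing u with
  | zero =>
    rw [walkMinor, walkMinor, ← map_sliceMatrix, ← map_minor]
    rfl
  | succ m ih =>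
    rw [walkMinor, walkMinor, map_mul, ih, ← map_sliceMatrix, ← map_minor]
    congr 2
    funext l c
    by_cases hl : l = ⟨j + (m + 1), h⟩
    · subst hl
      rw [Function.update_self, Function.update_self]
      exact map_cramerVec (f : A →+* B) _ _ _ _ _
    · rw [Function.update_of_ne hl, Function.update_of_ne hl]

open MvPolynomial in
-- `S` bounds the entries of every slice. One Cramer step adds a coordinate of degree at most `N * S
-- + 1`, so `S` becomes `N * S + 1 + S`, at most `(N + 2) * S`. The summand `S` on the left absorbs
-- the degrees of the minors. Order `N + 1` is allowed at `j` for the bootstrap.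
theorem totalDegree_walkMinor_add_le {σ : Type*} {j N : ℕ}
    (hs : ∀ i : Fin d, j < i → s i ≤ N) (hj : ∀ i : Fin d, (i : ℕ) = j → s i ≤ N + 1)
    (m : ℕ) (h : j + m < d) (u : Fin d → Fin n → MvPolynomial σ K) (e : Fin d → ℕ)
    (hu : ∀ l c, (u l c).totalDegree ≤ e l) {S : ℕ} (hS : 1 ≤ S) (he : ∑ l, e l ≤ S)
    (z : Fin m → Fin n → MvPolynomial σ K) (hz : ∀ k c, (z k c).totalDegree ≤ 1) :
    (walkMinor T I J j m h u z).totalDegree + S ≤ (N + 2) ^ (m + 1) * S := by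
  induction m generalizing u e S with
  | zero =>
    have h1 := totalDegree_minor_le (sliceMatrix T ⟨j, h⟩ u) (fun a b =>
      (totalDegree_sliceMatrix_le T ⟨j, h⟩ u e hu a b).trans he) (I ⟨j, h⟩) (J ⟨j, h⟩)
    have h2 := Nat.mul_le_mul_right S (hj ⟨j, h⟩ rfl)
    calc _ ≤ (N + 1) * S + S := Nat.add_le_add_right (h1.trans h2) S
      _ = _ := by ring
  | succ m ih =>
    set i : Fin d := ⟨j + (m + 1), h⟩ with hi
    have hsl := fun a b => (totalDegree_sliceMatrix_le T i u e hu a b).trans he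
    have h1 : (minor (sliceMatrix T i u) (I i) (J i)).totalDegree ≤ s i * S :=
      totalDegree_minor_le _ hsl _ _
    have h2 := totalDegree_cramerVec_le _ hsl (I i) (J i) (z 0) (hz 0)
    have hsN : s i ≤ N := hs i (by simp [hi])
    have hsS := Nat.mul_le_mul_right S hsN
    have h3 := ih (by omega) (Function.update u i
        (cramerVec (sliceMatrix T i u) (I i) (J i) (z 0)))
      (Function.update e i (s i * S + 1)) (fun l c => by
        by_cases hl : l = i
        · subst hl; simpa using h2 c
        · simpa [hl] using hu l c) (S := N * S + 1 + S) (by omega) (by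
        rw [Finset.sum_update_of_mem (Finset.mem_univ i)]
        have : ∑ l ∈ Finset.univ \ {i}, e l ≤ ∑ l, e l :=
          Finset.sum_le_sum_of_subset (Finset.subset_univ _)
        omega) (fun k => z k.succ) (fun k => hz k.succ)
    have h4 : (walkMinor T I J j (m + 1) h u z).totalDegree ≤ _ := totalDegree_mul (minor (sliceMatrix T i u) (I i) (J i))
      (walkMinor T I J j m (by omega) (Function.update u i
        (cramerVec (sliceMatrix T i u) (I i) (J i) (z 0))) (fun k => z k.succ))
    have h5 : (N + 2) ^ (m + 1) * (N * S + 1 + S) ≤ (N + 2) ^ (m + 1 + 1) * S := by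
      rw [pow_succ (N + 2) (m + 1), mul_assoc]
      refine Nat.mul_le_mul_left _ ?_
      nlinarith
    omega

open MvPolynomial in
-- From a constant starting point the first minor is constant and the first new coordinate has
-- degree at most one. This saves one factor `N + 2`, which gives the exponent `d - 1` in the
-- theorem.
theorem totalDegree_walkMinor_le {σ : Type*} {j N : ℕ}
    (hs : ∀ i : Fin d, j < i → s i ≤ N) (hj : ∀ i : Fin d, (i : ℕ) = j → s i ≤ N + 1)
    (m : ℕ) (h : j + m < d) (u : Fin d → Fin n → MvPolynomial σ K)
    (hu : ∀ l c, (u l c).totalDegree = 0)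
    (z : Fin m → Fin n → MvPolynomial σ K) (hz : ∀ k c, (z k c).totalDegree ≤ 1) :
    (walkMinor T I J j m h u z).totalDegree ≤ (N + 2) ^ m := by
  have hsl : ∀ i a b, (sliceMatrix T i u a b).totalDegree ≤ 0 := fun i a b => by
    simpa using totalDegree_sliceMatrix_le T i u 0 (fun l c => (hu l c).le) a b
  have h1 : ∀ i, (minor (sliceMatrix T i u) (I i) (J i)).totalDegree ≤ 0 := fun i => by
    simpa using totalDegree_minor_le _ (hsl i) (I i) (J i)
  cases m with
  | zero => exact (h1 _).trans (Nat.zero_le _)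
  | succ m =>
    set i : Fin d := ⟨j + (m + 1), h⟩ with hi
    have h2 := totalDegree_cramerVec_le _ (hsl i) (I i) (J i) (z 0) (hz 0)
    have h3 := totalDegree_walkMinor_add_le T I J hs hj m (by omega) (Function.update u i
        (cramerVec (sliceMatrix T i u) (I i) (J i) (z 0)))
      (Function.update 0 i 1) (fun l c => by
        by_cases hl : l = i
        · subst hl; simpa using h2 c
        · simp [hl, hu l c]) (S := 1) le_rfl (by simp [Finset.sum_update_of_mem])
        (fun k => z k.succ) (fun k => hz k.succ)
    have h4 : (walkMinor T I J j (m + 1) h u z).totalDegree ≤ _ := totalDegree_mul (minor (sliceMatrix T i u) (I i) (J i))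
      (walkMinor T I J j m (by omega) (Function.update u i
        (cramerVec (sliceMatrix T i u) (I i) (J i) (z 0))) (fun k => z k.succ))
    have h5 := h1 i
    omega

/-- With the seed `x i` divided by its minor, Cramer's rule returns `x i` itself, so the
parametrized walk follows `x`. -/
theorem exists_walkMinor_ne_zero {L : Type*} [Field L] [Algebra K L] (p x : Fin d → Fin n → L)
    (hx : IsAdjoint (extend L T) p x) (j : ℕ)
    (hD : ∀ i : Fin d, j ≤ i →
      minor (sliceMatrix T i (splice ((i : ℕ) + 1) p x)) (I i) (J i) ≠ 0) (m : ℕ)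
    (h : j + m < d) :
    ∃ z : Fin m → Fin n → L, walkMinor T I J j m h (splice (j + m + 1) p x) z ≠ 0 := by
  induction m with
  | zero => exact ⟨0, hD ⟨j, h⟩ le_rfl⟩
  | succ m ih =>
    obtain ⟨z, hz⟩ := ih (by omega)
    set i : Fin d := ⟨j + (m + 1), h⟩ with hi
    have hDi := hD i (by simp [hi])
    set D := minor (sliceMatrix T i (splice ((i : ℕ) + 1) p x)) (I i) (J i) with hDdef
    refine ⟨Fin.cons (D⁻¹ • x i) z, ?_⟩
    have hker : (sliceMatrix T i (splice ((i : ℕ) + 1) p x)).mulVec (D⁻¹ • x i) = 0 := by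
      rw [Matrix.mulVec_smul, sliceMatrix_mulVec, update_splice_succ, Function.update_eq_self,
        hx i (by simp [hi]; omega) h, smul_zero]
    rw [walkMinor]
    refine mul_ne_zero hDi ?_
    have h1 := cramerVec_of_mulVec_eq_zero _ (I i) (J i) hker
    rw [← hDdef, smul_inv_smul₀ hDi] at h1
    simp only [Fin.cons_zero, Fin.cons_succ]
    have h2 : Function.update (splice ((i : ℕ) + 1) p x) i
        (cramerVec (sliceMatrix T i (splice ((i : ℕ) + 1) p x)) (I i) (J i) (D⁻¹ • x i))
        = splice (j + m + 1) p x := by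
      rw [h1, update_splice_succ, Function.update_eq_self]
      rfl
    exact (congrArg (fun w => walkMinor T I J j m (by omega) w z ≠ 0) h2).mpr hz

end WalkMinor

/-- `u` is the state of a partial walk at `p`, in which the coordinates from `i` on have been
replaced, and whose ranks agree with `R` so far. -/
def IsGoodState {K : Type*} [Field K] {n d : ℕ} (T : TensorMap K n d) (p : Fin d → Fin n → K)
    (R : Colex (Fin d → ℕ)) (i : ℕ) (u : Fin d → Fin n → K) : Prop :=
  ∃ x : Fin d → Fin n → K, u = splice i p x ∧
    (∀ l : ℕ, i ≤ l → l < d → T (splice l p x) = 0) ∧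
    ∀ l : Fin d, i ≤ l →
      Module.finrank K (LinearMap.range (T.toLinearMap (splice ((l : ℕ) + 1) p x) l)) = ofColex R l

/-! ### Walks whose ranks follow a colexicographic upper bound -/

section GoodState

variable {K : Type*} [Field K] {n d : ℕ} {T : TensorMap K n d} {p : Fin d → Fin n → K}
  {R : Colex (Fin d → ℕ)}

theorem isGoodState_top : IsGoodState T p R d p := by
  refine ⟨0, ?_, fun l h1 h2 => by omega, fun l h => by have := l.2; omega⟩
  funext l
  simp [splice]

/-- Setting the coordinates of `x` up to `i` to zero gives an adjoint pair with ranks still equal to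
`R` after `i`; the colexicographic bound then applies at `i`. -/
theorem IsGoodState.rank_le (hR : R ∈ upperBounds (rankTuples T p)) {i : Fin d}
    {u : Fin d → Fin n → K} (h : IsGoodState T p R ((i : ℕ) + 1) u) :
    Module.finrank K (LinearMap.range (T.toLinearMap u i)) ≤ ofColex R i := by
  obtain ⟨x, rfl, h1, h2⟩ := h
  let y : Fin d → Fin n → K := fun l => if l ≤ i then 0 else x l
  have hy : ∀ l : ℕ, (i : ℕ) < l → splice l p y = splice l p x := by
    intro l hl
    funext a
    by_cases ha : (a : ℕ) < l
    · simp [splice, ha]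
    · have : ¬ a ≤ i := by rw [Fin.le_def]; omega
      simp [splice, ha, y, this]
  have hadj : IsAdjoint T p y := by
    intro l hl1 hl2
    by_cases hl : (i : ℕ) < l
    · rw [hy l hl, h1 l hl hl2]
    · refine T.map_coord_zero ⟨l, hl2⟩ ?_
      have : (⟨l, hl2⟩ : Fin d) ≤ i := by rw [Fin.le_def]; simpa using hl
      simp [splice, y, this]
  have h3 := Pi.apply_le_of_toColex (i := i) (hR ⟨y, hadj, rfl⟩ : rankTuple T p y ≤ R)
    (fun l hl => by
      have hl' : (i : ℕ) < (l : ℕ) + 1 := by rw [gt_iff_lt, Fin.lt_def] at hl; omega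
      change Module.finrank K (LinearMap.range (T.toLinearMap (splice ((l : ℕ) + 1) p y) l)) = _
      rw [hy _ hl']
      exact h2 l hl)
  change Module.finrank K (LinearMap.range (T.toLinearMap (splice ((i : ℕ) + 1) p y) i)) ≤ _ at h3
  rwa [hy _ (Nat.lt_succ_self _)] at h3

theorem IsGoodState.update {i : Fin d} {u : Fin d → Fin n → K}
    (h : IsGoodState T p R ((i : ℕ) + 1) u)
    (hr : Module.finrank K (LinearMap.range (T.toLinearMap u i)) = ofColex R i)
    {v : Fin n → K} (hv : T (Function.update u i v) = 0) :
    IsGoodState T p R i (Function.update u i v) := by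
  obtain ⟨x, rfl, h1, h2⟩ := h
  refine ⟨Function.update x i v, update_splice_succ p x i v, fun l hl hld => ?_, fun l hl => ?_⟩
  · rcases hl.eq_or_lt with rfl | hl
    · rw [← update_splice_succ, hv]
    · rw [splice_update_of_lt p x hl, h1 l hl hld]
  · rw [splice_update_of_lt p x (Nat.lt_succ_of_le hl)]
    rcases hl.eq_or_lt with hl' | hl'
    · rw [← Fin.ext hl', hr]
    · exact h2 l hl'

/-- The minor bounds the rank from below and `R` bounds it from above, so the rank is exactly `s`
and Cramer's vector lies in the kernel. -/
theorem IsGoodState.cramer {s : ℕ} (hR : R ∈ upperBounds (rankTuples T p)) {i : Fin d}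
    {u : Fin d → Fin n → K} (h : IsGoodState T p R ((i : ℕ) + 1) u) {I J : Fin s → Fin n}
    (hs : s = ofColex R i) (hD : minor (sliceMatrix T i u) I J ≠ 0) (z : Fin n → K) :
    T (Function.update u i (cramerVec (sliceMatrix T i u) I J z)) = 0 ∧
      IsGoodState T p R i (Function.update u i (cramerVec (sliceMatrix T i u) I J z)) := by
  have h1 := h.rank_le hR
  have h2 := le_rank_of_minor_ne_zero _ hD
  rw [rank_sliceMatrix_self] at h2
  have h3 : T (Function.update u i (cramerVec (sliceMatrix T i u) I J z)) = 0 := by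
    rw [← sliceMatrix_mulVec_self]
    exact mulVec_cramerVec _ hD (by rw [rank_sliceMatrix_self]; omega) z
  exact ⟨h3, h.update (by omega) h3⟩

theorem IsGoodState.exists_of_walkMinor_ne_zero (hR : R ∈ upperBounds (rankTuples T p))
    {s : Fin d → ℕ} (I J : ∀ i, Fin (s i) → Fin n) {j : ℕ}
    (hs : ∀ i : Fin d, j < i → s i = ofColex R i) (m : ℕ) (h : j + m < d)
    {u : Fin d → Fin n → K} (hu : IsGoodState T p R (j + m + 1) u) {z : Fin m → Fin n → K}
    (hz : walkMinor T I J j m h u z ≠ 0) :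
    ∃ w, IsGoodState T p R (j + 1) w ∧
      s ⟨j, by omega⟩
        ≤ Module.finrank K (LinearMap.range (T.toLinearMap w ⟨j, by omega⟩)) := by
  induction m generalizing u with
  | zero =>
    refine ⟨u, hu, ?_⟩
    rw [← rank_sliceMatrix_self]
    exact le_rank_of_minor_ne_zero _ hz
  | succ m ih =>
    rw [walkMinor] at hz
    have hD := left_ne_zero_of_mul hz
    exact ih (by omega) (IsGoodState.cramer (i := ⟨j + (m + 1), h⟩) hR hu
      (hs _ (by simp)) hD (z 0)).2 (right_ne_zero_of_mul hz)

theorem mem_rankTuples_of_walkMinor_ne_zero (hd : 0 < d) (hR : R ∈ upperBounds (rankTuples T p))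
    {s : Fin d → ℕ} (I J : ∀ i, Fin (s i) → Fin n) (hs : ∀ i : Fin d, s i = ofColex R i)
    {z : Fin (d - 1) → Fin n → K}
    (hz : walkMinor T I J 0 (d - 1) (by omega) p z ≠ 0) : R ∈ rankTuples T p := by
  have hu : IsGoodState T p R (0 + (d - 1) + 1) p := by
    have : 0 + (d - 1) + 1 = d := by omega
    rw [this]
    exact isGoodState_top
  obtain ⟨w, hw, hle⟩ := hu.exists_of_walkMinor_ne_zero hR I J (fun i _ => hs i) _ (by omega) hz
  have hle2 := IsGoodState.rank_le (i := ⟨0, hd⟩) hR hw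
  rw [hs] at hle
  obtain ⟨x, rfl, h1, h2⟩ := hw
  refine ⟨x, fun i hi hid => h1 i hi hid, ?_⟩
  refine congrArg toColex (funext fun i => ?_)
  by_cases hi : (i : ℕ) = 0
  · obtain rfl : i = ⟨0, hd⟩ := Fin.ext hi
    exact le_antisymm hle hle2
  · exact (h2 i (by omega)).symm

end GoodState

/-! ### Random walks and random seeds -/

section Average

variable {K : Type*} [Field K] [Fintype K] [DecidableEq K] {n d : ℕ}

/-- The average of `f` over the zeros of `T` which agree with `u` off coordinate `i`. -/
noncomputable def resample (T : TensorMap K n d) (i : Fin d) (f : (Fin d → Fin n → K) → ℝ)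
    (u : Fin d → Fin n → K) : ℝ :=
  (∑ v with T (Function.update u i v) = 0, f (Function.update u i v))
    / (Finset.univ.filter fun v => T (Function.update u i v) = 0).card

/-- The expected rank of the slice in direction `j` after resampling the coordinates
`j + m, …, j + 1` of `u` in this order. -/
noncomputable def expRank (T : TensorMap K n d) (j : ℕ) :
    ∀ m : ℕ, j + m < d → (Fin d → Fin n → K) → ℝ
  | 0, h, u => Module.finrank K (LinearMap.range (T.toLinearMap u ⟨j, h⟩))
  | m + 1, h, u => resample T ⟨j + (m + 1), h⟩ (expRank T j m (by omega)) u

theorem expRank_nonneg (T : TensorMap K n d) (j m : ℕ) (h : j + m < d)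
    (u : Fin d → Fin n → K) : 0 ≤ expRank T j m h u := by
  induction m generalizing u with
  | zero => exact Nat.cast_nonneg _
  | succ m ih =>
    exact div_nonneg (Finset.sum_nonneg fun v _ => ih _ _) (Nat.cast_nonneg _)

theorem card_mul_sum_comp {G H : Type*} [AddGroup G] [Fintype G] [AddGroup H] [Fintype H]
    [DecidableEq H] (φ : G →+ H) (S : Finset H) (hS : ∀ y, y ∈ S ↔ y ∈ Set.range φ)
    (f : H → ℝ) : (S.card : ℝ) * ∑ x, f (φ x) = (Fintype.card G : ℝ) * ∑ y ∈ S, f y := by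
  have hmaps : ∀ x ∈ (Finset.univ : Finset G), φ x ∈ S := fun x _ => (hS _).2 ⟨x, rfl⟩
  have hcard : ∀ y ∈ S, (Finset.univ.filter fun x => φ x = y).card
      = (Finset.univ.filter fun x => φ x = 0).card := fun y hy =>
    AddMonoidHom.card_fiber_eq_of_mem_range φ ((hS y).1 hy) ⟨0, map_zero φ⟩
  have h1 : ∑ x, f (φ x) = ((Finset.univ.filter fun x => φ x = 0).card : ℝ) * ∑ y ∈ S, f y := by
    rw [← Finset.sum_fiberwise_of_maps_to hmaps, Finset.mul_sum]
    refine Finset.sum_congr rfl fun y hy => ?_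
    rw [Finset.sum_congr rfl (fun x hx => by rw [(Finset.mem_filter.1 hx).2] :
      ∀ x ∈ Finset.univ.filter (fun x => φ x = y), f (φ x) = f y), Finset.sum_const,
      nsmul_eq_mul, hcard y hy]
  have h2 : Fintype.card G = S.card * (Finset.univ.filter fun x => φ x = 0).card := by
    rw [← Finset.card_univ, Finset.card_eq_sum_card_fiberwise hmaps,
      Finset.sum_congr rfl hcard, Finset.sum_const, smul_eq_mul]
  rw [h1, h2]
  push_cast
  ring

/-- Cramer's map is additive with image the whole kernel of the slice, so its fibres have equal
size: a uniform seed yields a uniform kernel vector. -/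
theorem resample_eq_of_minor_ne_zero (T : TensorMap K n d) {s : ℕ} {i : Fin d}
    {u : Fin d → Fin n → K} {I J : Fin s → Fin n}
    (hD : minor (sliceMatrix T i u) I J ≠ 0)
    (hT : ∀ z, T (Function.update u i (cramerVec (sliceMatrix T i u) I J z)) = 0)
    (f : (Fin d → Fin n → K) → ℝ) :
    resample T i f u * (Fintype.card (Fin n → K) : ℝ)
      = ∑ z, f (Function.update u i (cramerVec (sliceMatrix T i u) I J z)) := by
  let φ : (Fin n → K) →+ (Fin n → K) :=
    { toFun := cramerVec (sliceMatrix T i u) I J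
      map_zero' := by
        rw [cramerVec_of_mulVec_eq_zero _ _ _ (Matrix.mulVec_zero _), smul_zero]
      map_add' := cramerVec_add _ _ _ }
  have h := card_mul_sum_comp φ (Finset.univ.filter fun v => T (Function.update u i v) = 0)
    (fun y => by
      simp only [Finset.mem_filter, Finset.mem_univ, true_and]
      refine ⟨fun hy => ⟨(minor (sliceMatrix T i u) I J)⁻¹ • y, ?_⟩, ?_⟩
      · refine (cramerVec_of_mulVec_eq_zero _ _ _ ?_).trans (smul_inv_smul₀ hD y)
        rw [Matrix.mulVec_smul, sliceMatrix_mulVec_self, hy, smul_zero]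
      · rintro ⟨z, rfl⟩
        exact hT z)
    (fun v => f (Function.update u i v))
  have h0 : ((Finset.univ.filter fun v => T (Function.update u i v) = 0).card : ℝ) ≠ 0 := by
    rw [Nat.cast_ne_zero, Finset.card_ne_zero]
    exact ⟨_, Finset.mem_filter.2 ⟨Finset.mem_univ _, hT 0⟩⟩
  rw [resample, div_mul_eq_mul_div, div_eq_iff h0, mul_comm, ← h, mul_comm]
  rfl

/-- Each nonvanishing seed leads to a final rank at least `s j`. If the current minor is zero, no
seed counts and the bound is trivial. -/
theorem IsGoodState.le_expRank {T : TensorMap K n d} {p : Fin d → Fin n → K}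
    {R : Colex (Fin d → ℕ)} (hR : R ∈ upperBounds (rankTuples T p))
    {s : Fin d → ℕ} (I J : ∀ i, Fin (s i) → Fin n) {j : ℕ}
    (hs : ∀ i : Fin d, j < i → s i = ofColex R i) (m : ℕ) (h : j + m < d)
    {u : Fin d → Fin n → K} (hu : IsGoodState T p R (j + m + 1) u) :
    (s ⟨j, by omega⟩ : ℝ)
        * (Finset.univ.filter fun z : Fin m → Fin n → K => walkMinor T I J j m h u z ≠ 0).card
      ≤ expRank T j m h u * (Fintype.card (Fin n → K) : ℝ) ^ m := by
  induction m generalizing u with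
  | zero =>
    rw [pow_zero, mul_one, expRank]
    by_cases hD : minor (sliceMatrix T ⟨j, h⟩ u) (I ⟨j, h⟩) (J ⟨j, h⟩) = 0
    · simp [walkMinor, hD]
    · have h1 := le_rank_of_minor_ne_zero _ hD
      rw [rank_sliceMatrix_self] at h1
      simpa [walkMinor, hD] using h1
  | succ m ih =>
    set i : Fin d := ⟨j + (m + 1), h⟩ with hi
    by_cases hD : minor (sliceMatrix T i u) (I i) (J i) = 0
    · have : ∀ z, walkMinor T I J j (m + 1) h u z = 0 := fun z => by
        rw [walkMinor, ← hi, hD, zero_mul]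
      simp only [this, ne_eq, not_true_eq_false, Finset.filter_false, Finset.card_empty,
        Nat.cast_zero, mul_zero]
      exact mul_nonneg (expRank_nonneg T j _ h u) (by positivity)
    · have hc := fun z => IsGoodState.cramer (i := i) hR hu (hs _ (by simp [hi])) hD z
      have h1 := resample_eq_of_minor_ne_zero T hD (fun z => (hc z).1)
        (expRank T j m (by omega))
      have h2 : ((Finset.univ.filter fun z : Fin (m + 1) → Fin n → K =>
          walkMinor T I J j (m + 1) h u z ≠ 0).card : ℝ)
          = ∑ v : Fin n → K, ((Finset.univ.filter fun z : Fin m → Fin n → K =>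
            walkMinor T I J j m (by omega)
              (Function.update u i (cramerVec (sliceMatrix T i u) (I i) (J i) v)) z ≠ 0).card :
              ℝ) := by
        simp only [Finset.card_filter]
        push_cast
        rw [← (Fin.consEquiv fun _ : Fin (m + 1) => Fin n → K).sum_comp,
          Fintype.sum_prod_type]
        refine Finset.sum_congr rfl fun v _ => Finset.sum_congr rfl fun z _ => ?_
        have h3 : walkMinor T I J j (m + 1) h u (Fin.cons v z)
            = minor (sliceMatrix T i u) (I i) (J i) * walkMinor T I J j m (by omega)
              (Function.update u i (cramerVec (sliceMatrix T i u) (I i) (J i) v)) z := rfl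
        change (if walkMinor T I J j (m + 1) h u (Fin.cons v z) ≠ 0 then (1 : ℝ) else 0) = _
        simp only [h3, ne_eq, mul_eq_zero, hD, false_or]
      rw [h2, Finset.mul_sum, expRank, pow_succ', ← mul_assoc, h1, Finset.sum_mul]
      exact Finset.sum_le_sum fun v _ => ih (by omega) (hc v).2

theorem card_eval_eq_zero_mul_le {σ : Type*} [Fintype σ] [DecidableEq σ] {P : MvPolynomial σ K}
    (hP : P ≠ 0) :
    ((Finset.univ.filter fun z : σ → K => MvPolynomial.eval z P = 0).card : ℝ) * Fintype.card K
      ≤ P.totalDegree * (Fintype.card K : ℝ) ^ Fintype.card σ := by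
  let e := Fintype.equivFin σ
  have hP' : MvPolynomial.rename e P ≠ 0 := fun h =>
    hP (MvPolynomial.rename_injective e e.injective (by rw [h, map_zero]))
  have h1 := MvPolynomial.schwartz_zippel_totalDegree hP' (Finset.univ : Finset K)
  have h2 : (Finset.univ.filter fun z : σ → K => MvPolynomial.eval z P = 0).card
      = (Finset.filter (fun f => MvPolynomial.eval f (MvPolynomial.rename e P) = 0)
        (Fintype.piFinset fun _ => Finset.univ)).card := by
    rw [Fintype.piFinset_univ]
    refine Finset.card_equiv (e.arrowCongr (Equiv.refl K)) fun z => ?_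
    simp [MvPolynomial.eval_rename, Function.comp_assoc, Equiv.arrowCongr]
  rw [← h2, Finset.card_univ, div_le_div_iff₀ (by positivity) (by positivity)] at h1
  have h3 : (MvPolynomial.rename e P).totalDegree ≤ P.totalDegree :=
    MvPolynomial.totalDegree_rename_le _ _
  have h4 := h1.trans (mul_le_mul_left (Nat.cast_le.2 h3) _)
  exact_mod_cast h4

end Average

/-! ### Comparison with the algebraic closure -/

section AlgClosure

variable {K : Type*} [Field K] {n d : ℕ}

theorem algLocalRank_mem_upperBounds (T : TensorMap K n d) (p : Fin d → Fin n → K) :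
    algLocalRank T p ∈ upperBounds (rankTuples T p) := fun _ hr =>
  (isGreatest_localRank _ _).2 (rankTuples_subset_extend T (AlgebraicClosure K) p hr)

theorem exists_minors (T : TensorMap K n d) (p : Fin d → Fin n → K) (s : Fin d → ℕ)
    (hs : ∀ i, s i ≤ ofColex (algLocalRank T p) i) :
    ∃ I J : ∀ i, Fin (s i) → Fin n, ∀ (j m : ℕ) (h : j + m < d), j + m + 1 = d →
      ∃ z : Fin m → Fin n → AlgebraicClosure K, walkMinor T I J j m h
        (fun l c => algebraMap K (AlgebraicClosure K) (p l c)) z ≠ 0 := by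
  obtain ⟨x, hx, hr⟩ := (isGreatest_localRank (extend (AlgebraicClosure K) T)
    (fun i j => algebraMap K (AlgebraicClosure K) (p i j))).1
  have h1 : ∀ i : Fin d, s i ≤ (sliceMatrix T i (splice ((i : ℕ) + 1)
      (fun i j => algebraMap K (AlgebraicClosure K) (p i j)) x)).rank := fun i => by
    rw [rank_sliceMatrix]
    refine (hs i).trans (le_of_eq ?_)
    exact congrFun (congrArg ofColex hr) i
  choose I J hIJ using fun i => exists_minor_ne_zero _ (h1 i)
  refine ⟨I, J, fun j m h hjm => ?_⟩
  have h2 := exists_walkMinor_ne_zero T I J _ x hx j (fun i _ => hIJ i) m h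
  have h3 : splice (j + m + 1) (fun i j => algebraMap K (AlgebraicClosure K) (p i j)) x
      = (fun i j => algebraMap K (AlgebraicClosure K) (p i j)) := by
    funext l
    have := l.2
    simp [splice, hjm]
  rwa [h3] at h2

end AlgClosure

/-! ### Schwartz-Zippel and stability -/

section Stability

variable {K : Type*} [Field K] [Fintype K] [DecidableEq K] {n d : ℕ}

theorem card_walkMinor_eq_zero_mul_le {L : Type*} [Field L] [Algebra K L] (T : TensorMap K n d)
    {s : Fin d → ℕ} (I J : ∀ i, Fin (s i) → Fin n) {j N : ℕ}
    (hs : ∀ i : Fin d, j < i → s i ≤ N) (hj : ∀ i : Fin d, (i : ℕ) = j → s i ≤ N + 1)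
    (m : ℕ) (h : j + m < d) (p : Fin d → Fin n → K)
    (hne : ∃ z : Fin m → Fin n → L,
      walkMinor T I J j m h (fun l c => algebraMap K L (p l c)) z ≠ 0) :
    ((Finset.univ.filter fun z : Fin m → Fin n → K => walkMinor T I J j m h p z = 0).card : ℝ)
        * Fintype.card K
      ≤ ((N : ℝ) + 2) ^ m * (Fintype.card (Fin n → K) : ℝ) ^ m := by
  obtain ⟨w, hw⟩ := hne
  let P : MvPolynomial (Fin m × Fin n) K :=
    walkMinor T I J j m h (fun l c => MvPolynomial.C (p l c)) (fun k c => MvPolynomial.X (k, c))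
  have hP : P ≠ 0 := by
    intro hP
    have h1 := map_walkMinor T I J (MvPolynomial.aeval fun kc : Fin m × Fin n => w kc.1 kc.2)
      j m h (fun l c => MvPolynomial.C (p l c)) (fun k c => MvPolynomial.X (k, c))
    simp only [MvPolynomial.aeval_X, MvPolynomial.aeval_C] at h1
    exact hw (h1.symm.trans ((congrArg _ hP).trans (map_zero _)))
  have hdeg : P.totalDegree ≤ (N + 2) ^ m :=
    totalDegree_walkMinor_le T I J hs hj m h _ (fun l c => MvPolynomial.totalDegree_C _) _
      (fun k c => by simp)
  have heval : ∀ z : Fin m × Fin n → K,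
      MvPolynomial.eval z P = walkMinor T I J j m h p (Function.curry z) := fun z => by
    have h1 := map_walkMinor T I J (MvPolynomial.aeval z)
      j m h (fun l c => MvPolynomial.C (p l c)) (fun k c => MvPolynomial.X (k, c))
    simp only [MvPolynomial.aeval_X, MvPolynomial.aeval_C] at h1
    exact h1
  have hcard : (Finset.univ.filter fun z : Fin m → Fin n → K =>
      walkMinor T I J j m h p z = 0).card
      = (Finset.univ.filter fun z : Fin m × Fin n → K => MvPolynomial.eval z P = 0).card := by
    symm
    refine Finset.card_equiv (Equiv.curry _ _ _) fun z => ?_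
    simp [heval]
  rw [hcard]
  refine (card_eval_eq_zero_mul_le hP).trans ?_
  have h2 : (Fintype.card (Fin n → K) : ℝ) ^ m
      = (Fintype.card K : ℝ) ^ Fintype.card (Fin m × Fin n) := by
    simp [Fintype.card_pi, ← pow_mul, mul_comm]
  rw [h2]
  exact mul_le_mul_of_nonneg_right (by exact_mod_cast hdeg) (by positivity)

/-- The expected rank is almost as large as the algebraic local rank. -/
theorem mul_sub_le_expRank_mul (T : TensorMap K n d) (p : Fin d → Fin n → K) {j m : ℕ}
    (h : j + m < d) (hjm : j + m + 1 = d) {t N : ℕ}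
    (ht : t ≤ ofColex (algLocalRank T p) ⟨j, by omega⟩) (htN : t ≤ N + 1)
    (hN : ∀ i : Fin d, j < i → ofColex (algLocalRank T p) i ≤ N) :
    (t : ℝ) * (Fintype.card K - ((N : ℝ) + 2) ^ m) ≤ expRank T j m h p * Fintype.card K := by
  -- Only a minor of order `t` is tested at `j`, while full rank is needed after `j` to stay in the
  -- kernels.
  let s : Fin d → ℕ := fun i => if (i : ℕ) = j then t else ofColex (algLocalRank T p) i
  have hsj : ∀ i : Fin d, (i : ℕ) = j → s i = t := fun i hi => if_pos hi
  have hs : ∀ i : Fin d, j < i → s i = ofColex (algLocalRank T p) i := fun i hi => if_neg hi.ne'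
  obtain ⟨I, J, hne⟩ := exists_minors T p s fun i => by
    by_cases hi : (i : ℕ) = j
    · rw [hsj i hi, show i = ⟨j, by omega⟩ from Fin.ext hi]
      exact ht
    · exact (if_neg hi).le
  have h1 := card_walkMinor_eq_zero_mul_le T I J (N := N) (fun i hi => (hs i hi).trans_le (hN i hi))
    (fun i hi => (hsj i hi).trans_le htN) m h p (hne j m h hjm)
  have htop : IsGoodState T p (algLocalRank T p) (j + m + 1) p := by
    rw [hjm]
    exact isGoodState_top
  have h2 := htop.le_expRank (algLocalRank_mem_upperBounds T p) I J hs m h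
  rw [hsj _ rfl] at h2
  have h3 := Finset.card_filter_add_card_filter_not (s := Finset.univ)
    (fun z : Fin m → Fin n → K => walkMinor T I J j m h p z = 0)
  rw [Finset.card_univ, Fintype.card_fun, Fintype.card_fin] at h3
  have h3' : ((Finset.univ.filter fun z : Fin m → Fin n → K =>
      walkMinor T I J j m h p z = 0).card : ℝ)
      + (Finset.univ.filter fun z : Fin m → Fin n → K => walkMinor T I J j m h p z ≠ 0).card
      = (Fintype.card (Fin n → K) : ℝ) ^ m := by exact_mod_cast h3
  set a : ℝ := ((Finset.univ.filter fun z : Fin m → Fin n → K =>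
      walkMinor T I J j m h p z = 0).card : ℝ)
  set b : ℝ := ((Finset.univ.filter fun z : Fin m → Fin n → K =>
      walkMinor T I J j m h p z ≠ 0).card : ℝ)
  have hV : (0 : ℝ) < (Fintype.card (Fin n → K) : ℝ) ^ m := by positivity
  set V : ℝ := (Fintype.card (Fin n → K) : ℝ) ^ m
  have hq : (0 : ℝ) < Fintype.card K := by positivity
  set q : ℝ := (Fintype.card K : ℝ)
  refine le_of_mul_le_mul_right ?_ hV
  calc (t : ℝ) * (q - ((N : ℝ) + 2) ^ m) * V
      = t * (q * V - ((N : ℝ) + 2) ^ m * V) := by ring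
    _ ≤ t * (q * V - a * q) :=
      mul_le_mul_of_nonneg_left (by linarith) (Nat.cast_nonneg _)
    _ = (t * b) * q := by rw [← h3']; ring
    _ ≤ (expRank T j m h p * V) * q := mul_le_mul_of_nonneg_right h2 hq.le
    _ = _ := by ring

/-- The vanishing fraction is below one, so some walk over `K` has all ranks equal to the algebraic
local rank. -/
theorem isLRStable_of_pow_lt_card (hd : 0 < d) (T : TensorMap K n d) (p : Fin d → Fin n → K)
    {N : ℕ} (hN : ∀ i : Fin d, ofColex (algLocalRank T p) i ≤ N)
    (hq : ((N : ℝ) + 2) ^ (d - 1) < Fintype.card K) : IsLRStable T p := by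
  obtain ⟨I, J, hne⟩ := exists_minors T p (fun i => ofColex (algLocalRank T p) i)
    fun i => le_rfl
  have h1 := card_walkMinor_eq_zero_mul_le T I J (j := 0) (N := N) (fun i _ => hN i)
    (fun i _ => (hN i).trans (Nat.le_succ _)) (d - 1) (by omega) p
    (hne 0 (d - 1) (by omega) (by omega))
  have hV : (0 : ℝ) < (Fintype.card (Fin n → K) : ℝ) ^ (d - 1) := by positivity
  obtain ⟨z, hz⟩ : ∃ z, walkMinor T I J 0 (d - 1) (by omega) p z ≠ 0 := by
    by_contra! hcon
    simp only [hcon, Finset.filter_true] at h1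
    rw [Finset.card_univ, Fintype.card_fun, Fintype.card_fin, Nat.cast_pow, mul_comm] at h1
    exact absurd (le_of_mul_le_mul_right h1 hV) hq.not_ge
  have h2 := mem_rankTuples_of_walkMinor_ne_zero hd (algLocalRank_mem_upperBounds T p) I J
    (fun i => rfl) hz
  exact (isGreatest_localRank T p).unique ⟨h2, algLocalRank_mem_upperBounds T p⟩

end Stability

theorem toMap_eq_zero_iff {K : Type*} [Field K] {n d : ℕ} (T : TensorForm K n (d + 1)) (y : Fin d → Fin n → K) :
    toMap T y = 0 ↔ T.curryRight y = 0 := by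
  refine ⟨fun h => ?_, fun h => ?_⟩
  · refine LinearMap.pi_ext' fun j => LinearMap.ext_ring ?_
    exact congrFun h j
  · funext j
    exact LinearMap.congr_fun h _

/-! ### Analytic rank and the uniform measure on zeros -/

section AnalyticRank

variable {K : Type*} [Field K] [Fintype K] [DecidableEq K] {n d : ℕ}

theorem sum_sum_update_swap {ι V : Type*} [Fintype ι] [DecidableEq ι] [Fintype V] (i : ι)
    (g : (ι → V) → V → ℝ) :
    ∑ u : ι → V, ∑ v, g (Function.update u i v) (u i) = ∑ u : ι → V, ∑ v, g u v := by
  rw [← Fintype.sum_prod_type', ← Fintype.sum_prod_type']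
  exact Fintype.sum_equiv
    { toFun := fun a => (Function.update a.1 i a.2, a.1 i)
      invFun := fun a => (Function.update a.1 i a.2, a.1 i)
      left_inv := fun a => by simp
      right_inv := fun a => by simp } _ _ fun a => rfl

theorem card_update_pos (T : TensorMap K n d) (i : Fin d) {u : Fin d → Fin n → K} :
    (0 : ℝ) < (Finset.univ.filter fun v => T (Function.update u i v) = 0).card := by
  rw [Nat.cast_pos, Finset.card_pos]
  exact ⟨0, by simp [T.map_update_zero]⟩

/-- Exchanging old and new values of coordinate `i` is an involution, and the number of admissible
values ignores coordinate `i`: the resampling chain is reversible. -/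
theorem sum_resample (T : TensorMap K n d) (i : Fin d) (f : (Fin d → Fin n → K) → ℝ) :
    ∑ u with T u = 0, resample T i f u = ∑ u with T u = 0, f u := by
  let g : (Fin d → Fin n → K) → (Fin n → K) → ℝ := fun w a =>
    if T w = 0 ∧ T (Function.update w i a) = 0 then
      f w / (Finset.univ.filter fun v => T (Function.update w i v) = 0).card else 0
  have h1 : ∀ u, (if T u = 0 then resample T i f u else 0)
      = ∑ v, g (Function.update u i v) (u i) := by
    intro u
    by_cases hu : T u = 0
    · simp only [if_true, resample, g, Function.update_idem, Function.update_eq_self, hu,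
        and_true, Finset.sum_filter, Finset.sum_div, ite_div, zero_div]
    · simp [g, hu]
  have h2 : ∀ u, (if T u = 0 then f u else 0) = ∑ v, g u v := by
    intro u
    by_cases hu : T u = 0
    · have := (card_update_pos T i (u := u)).ne'
      simp only [if_true, g, hu, true_and, ← Finset.sum_filter, Finset.sum_const, nsmul_eq_mul]
      field_simp
    · simp [g, hu]
  rw [Finset.sum_filter, Finset.sum_filter, Finset.sum_congr rfl fun u _ => h1 u,
    Finset.sum_congr rfl fun u _ => h2 u, sum_sum_update_swap]

theorem sum_expRank (T : TensorMap K n d) (j m : ℕ) (h : j + m < d) :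
    ∑ u with T u = 0, expRank T j m h u
      = ∑ u with T u = 0,
        (Module.finrank K (LinearMap.range (T.toLinearMap u ⟨j, by omega⟩)) : ℝ) := by
  induction m with
  | zero => rfl
  | succ m ih => exact (sum_resample T _ _).trans (ih _)

theorem pow_rank_mul_card_update (T : TensorMap K n d) (i : Fin d) (u : Fin d → Fin n → K) :
    (Fintype.card K : ℝ) ^ Module.finrank K (LinearMap.range (T.toLinearMap u i))
      * (Finset.univ.filter fun v => T (Function.update u i v) = 0).card
      = Fintype.card (Fin n → K) := by
  have h1 : (Finset.univ.filter fun v => T (Function.update u i v) = 0).card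
      = Fintype.card K ^ Module.finrank K (LinearMap.ker (T.toLinearMap u i)) := by
    rw [← Nat.card_eq_fintype_card (α := K), ← Module.natCard_eq_pow_finrank,
      ← Fintype.card_subtype, ← Nat.card_eq_fintype_card]
    rfl
  have h2 := LinearMap.finrank_range_add_finrank_ker (T.toLinearMap u i)
  rw [Module.finrank_fin_fun] at h2
  rw [h1, Fintype.card_fun, Fintype.card_fin]
  push_cast
  rw [← pow_add, h2]

/-- A line in direction `i` with `c` zeros contributes `c` terms, each `|V| / c`, hence `|V|` in
total. -/
theorem sum_pow_rank (T : TensorMap K n d) (i : Fin d) :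
    ∑ u with T u = 0,
      (Fintype.card K : ℝ) ^ Module.finrank K (LinearMap.range (T.toLinearMap u i))
      = Fintype.card (Fin d → Fin n → K) := by
  let g : (Fin d → Fin n → K) → (Fin n → K) → ℝ := fun w _ =>
    if T w = 0 then
      1 / ((Finset.univ.filter fun v => T (Function.update w i v) = 0).card : ℝ) else 0
  have h1 : ∀ u, (1 : ℝ) = ∑ v, g (Function.update u i v) (u i) := by
    intro u
    have := (card_update_pos T i (u := u)).ne'
    simp only [g, Function.update_idem, ← Finset.sum_filter, Finset.sum_const, nsmul_eq_mul]
    field_simp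
  have h2 : ∀ u, (if T u = 0 then (Fintype.card K : ℝ) ^
      Module.finrank K (LinearMap.range (T.toLinearMap u i)) else 0) = ∑ v, g u v := by
    intro u
    have := (card_update_pos T i (u := u)).ne'
    by_cases hu : T u = 0
    · simp only [g, hu, if_true, Finset.sum_const, Finset.card_univ, nsmul_eq_mul]
      rw [← pow_rank_mul_card_update T i u]
      field_simp
    · simp [g, hu]
  rw [Finset.sum_filter, Finset.sum_congr rfl fun u _ => h2 u, ← sum_sum_update_swap i g,
    ← Finset.sum_congr rfl fun u _ => h1 u]
  simp

theorem card_apply_eq_zero_sub (ℓ : (Fin n → K) →ₗ[K] K) :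
    ((Finset.univ.filter fun v => ℓ v = 0).card : ℝ) - (Finset.univ.filter fun v => ℓ v = 1).card
      = if ℓ = 0 then (Fintype.card (Fin n → K) : ℝ) else 0 := by
  split_ifs with h
  · simp [h]
  · have h1 : Function.Surjective ℓ := LinearMap.surjective h
    rw [sub_eq_zero, Nat.cast_inj]
    exact AddMonoidHom.card_fiber_eq_of_mem_range ℓ.toAddMonoidHom (h1 0) (h1 1)

theorem bias_eq (T : TensorForm K n (d + 1)) :
    bias T = (Finset.univ.filter fun u => toMap T u = 0).card
      / (Fintype.card (Fin d → Fin n → K) : ℝ) := by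
  have h1 : ∀ a : K, (Nat.card {x : Fin (d + 1) → Fin n → K // T x = a} : ℝ)
      = ∑ y : Fin d → Fin n → K,
        ((Finset.univ.filter fun v => T.curryRight y v = a).card : ℝ) := by
    intro a
    rw [Nat.card_eq_fintype_card, Fintype.card_subtype]
    simp only [Finset.card_filter]
    push_cast
    rw [← (Fin.snocEquiv fun _ : Fin (d + 1) => Fin n → K).sum_comp, Fintype.sum_prod_type,
      Finset.sum_comm]
    rfl
  have h2 : (Nat.card (Fin (d + 1) → Fin n → K) : ℝ)
      = Fintype.card (Fin n → K) * Fintype.card (Fin d → Fin n → K) := by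
    rw [Nat.card_eq_fintype_card]
    simp only [Fintype.card_fun, Fintype.card_fin]
    push_cast
    ring
  have h3 : (0 : ℝ) < Fintype.card (Fin n → K) := by
    exact_mod_cast Fintype.card_pos
  have h4 : ∀ y, (if T.curryRight y = 0 then (Fintype.card (Fin n → K) : ℝ) else 0)
      = if toMap T y = 0 then (Fintype.card (Fin n → K) : ℝ) else 0 := fun y =>
    if_congr (toMap_eq_zero_iff T y).symm rfl rfl
  rw [bias, h1, h1, h2, ← Finset.sum_sub_distrib,
    Finset.sum_congr rfl fun y _ => (card_apply_eq_zero_sub (T.curryRight y)).trans (h4 y),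
    ← Finset.sum_filter, Finset.sum_const, nsmul_eq_mul, mul_comm, mul_div_mul_left _ _ h3.ne']

theorem card_zeros_pos (hd : 0 < d) (T : TensorMap K n d) :
    (0 : ℝ) < (Finset.univ.filter fun u => T u = 0).card := by
  rw [Nat.cast_pos, Finset.card_pos]
  exact ⟨0, Finset.mem_filter.2 ⟨Finset.mem_univ _, T.map_coord_zero ⟨0, hd⟩ rfl⟩⟩

theorem analyticRank_nonneg (T : TensorForm K n (d + 1)) : 0 ≤ analyticRank T := by
  have hq : (1 : ℝ) < Nat.card K := by exact_mod_cast Finite.one_lt_card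
  rw [analyticRank, neg_nonneg, bias_eq]
  refine Real.logb_nonpos hq (by positivity) (div_le_one_of_le₀ ?_ (by positivity))
  exact_mod_cast Finset.card_le_univ _

/-- The average rank of a slice over the zeros of `T` is at most the analytic rank. -/
theorem sum_rank_le (hd : 0 < d) (T : TensorForm K n (d + 1)) (i : Fin d) :
    ∑ u with toMap T u = 0,
        (Module.finrank K (LinearMap.range ((toMap T).toLinearMap u i)) : ℝ)
      ≤ (Finset.univ.filter fun u => toMap T u = 0).card * analyticRank T := by
  have hq : (1 : ℝ) < Fintype.card K := by exact_mod_cast Fintype.one_lt_card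
  have hZ := card_zeros_pos hd (toMap T)
  have hsum := sum_pow_rank (toMap T) i
  have hV : (0 : ℝ) < Fintype.card (Fin d → Fin n → K) := by exact_mod_cast Fintype.card_pos
  have hAR : analyticRank T * Real.log (Fintype.card K)
      = Real.log (Fintype.card (Fin d → Fin n → K)
        / (Finset.univ.filter fun u => toMap T u = 0).card) := by
    rw [analyticRank, bias_eq, Nat.card_eq_fintype_card, ← Real.logb_inv, inv_div, Real.logb,
      div_mul_cancel₀ _ (Real.log_pos hq).ne']
  set q : ℝ := (Fintype.card K : ℝ)
  set V : ℝ := (Fintype.card (Fin d → Fin n → K) : ℝ)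
  set Z : ℝ := ((Finset.univ.filter fun u => toMap T u = 0).card : ℝ) with hZdef
  refine le_of_mul_le_mul_right ?_ (Real.log_pos hq)
  rw [mul_assoc, hAR, Finset.sum_mul]
  -- Jensen in tangent-line form, `log t ≤ t - 1` at `t = q ^ r * Z / V`; the terms `t - 1` sum to
  -- zero over the zeros.
  have h1 : ∀ r : ℕ, (r : ℝ) * Real.log q ≤ q ^ r * (Z / V) - 1 + Real.log (V / Z) := by
    intro r
    have h2 := Real.log_le_sub_one_of_pos (show 0 < q ^ r * (Z / V) by positivity)
    rw [Real.log_mul (by positivity) (by positivity), Real.log_pow, ← inv_div,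
      Real.log_inv] at h2
    rw [← inv_div V Z]
    linarith
  refine (Finset.sum_le_sum fun u _ => h1 _).trans (le_of_eq ?_)
  rw [Finset.sum_add_distrib, Finset.sum_sub_distrib, ← Finset.sum_mul, hsum, Finset.sum_const,
    Finset.sum_const, nsmul_eq_mul, nsmul_eq_mul, ← hZdef]
  field_simp
  ring

end AnalyticRank

theorem sum_two_pow_weights (d : ℕ) :
    ∑ j : Fin d, (2 : ℝ) ^ (d - ((j : ℕ) + 1)) = 2 ^ d - 1 := by
  rw [Fin.sum_univ_eq_sum_range (fun j => (2 : ℝ) ^ (d - (j + 1))) d]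
  have h := Finset.sum_range_reflect (fun j => (2 : ℝ) ^ j) d
  have h2 : ∀ j, d - (j + 1) = d - 1 - j := fun j => by omega
  rw [Finset.sum_congr rfl fun j _ => congrArg (fun m => (2 : ℝ) ^ m) (h2 j), h,
    geom_sum_eq (by norm_num)]
  norm_num

/-! ### Choice of the point and conclusion -/

section Main

variable {K : Type*} [Field K] [Fintype K] [DecidableEq K] {n d : ℕ}

theorem exists_sum_expRank_le (hd : 0 < d) (T : TensorForm K n (d + 1)) :
    ∃ p : Fin d → Fin n → K,
      ∑ j : Fin d, (2 : ℝ) ^ (d - ((j : ℕ) + 1))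
          * expRank (toMap T) j (d - ((j : ℕ) + 1)) (by omega) p
        ≤ (2 ^ d - 1) * analyticRank T := by
  have hZ := card_zeros_pos hd (toMap T)
  have hne : (Finset.univ.filter fun u => toMap T u = 0).Nonempty := by
    rwa [Nat.cast_pos, Finset.card_pos] at hZ
  obtain ⟨p, -, hp⟩ := Finset.exists_le_of_sum_le (s := Finset.univ.filter fun u => toMap T u = 0)
    (f := fun p => ∑ j : Fin d, (2 : ℝ) ^ (d - ((j : ℕ) + 1))
      * expRank (toMap T) j (d - ((j : ℕ) + 1)) (by omega) p)
    (g := fun _ => (2 ^ d - 1) * analyticRank T) hne (by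
      rw [Finset.sum_comm]
      simp only [← Finset.mul_sum, sum_expRank]
      refine (Finset.sum_le_sum fun j _ =>
        mul_le_mul_of_nonneg_left (sum_rank_le hd T j) (by positivity)).trans (le_of_eq ?_)
      rw [← Finset.sum_mul, sum_two_pow_weights, Finset.sum_const, nsmul_eq_mul])
  exact ⟨p, hp⟩

theorem expRank_le_of_sum_le (T : TensorMap K n d) (p : Fin d → Fin n → K) {X : ℝ}
    (h : ∑ j : Fin d, (2 : ℝ) ^ (d - ((j : ℕ) + 1))
      * expRank T j (d - ((j : ℕ) + 1)) (by omega) p ≤ X) (j : Fin d) :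
    expRank T j (d - ((j : ℕ) + 1)) (by omega) p ≤ X := by
  have h1 := Finset.single_le_sum (f := fun j : Fin d => (2 : ℝ) ^ (d - ((j : ℕ) + 1))
      * expRank T j (d - ((j : ℕ) + 1)) (by omega) p)
    (fun i _ => mul_nonneg (by positivity) (expRank_nonneg T _ _ _ p)) (Finset.mem_univ j)
  have h2 : (1 : ℝ) ≤ 2 ^ (d - ((j : ℕ) + 1)) := one_le_pow₀ (by norm_num)
  exact (le_mul_of_one_le_left (expRank_nonneg T _ _ _ p) h2).trans (h1.trans h)

theorem algLocalRank_le_of_expRank_le (T : TensorMap K n d) (p : Fin d → Fin n → K) {X : ℝ}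
    {N : ℕ} (hX : ∀ j : Fin d, expRank T j (d - ((j : ℕ) + 1)) (by omega) p ≤ X)
    (hN : 2 * X < N + 1) (hq : 2 * ((N : ℝ) + 2) ^ (d - 1) ≤ Fintype.card K) (j : Fin d) :
    ofColex (algLocalRank T p) j ≤ N := by
  suffices H : ∀ (m : ℕ) (j : Fin d), (j : ℕ) + m + 1 = d → ofColex (algLocalRank T p) j ≤ N from
    H (d - ((j : ℕ) + 1)) j (by omega)
  intro m
  induction m using Nat.strong_induction_on with
  | _ m ih =>
    intro j hj
    by_contra! hlt
    -- Testing only order `N + 1`, however large the rank, keeps the degree bounded in terms of `N`.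
    have h1 := mul_sub_le_expRank_mul T p (j := j) (m := m) (by omega) hj (t := N + 1) (N := N)
      hlt le_rfl (fun i hi => ih (d - ((i : ℕ) + 1)) (by omega) i (by omega))
    have h2 := hX j
    obtain rfl : m = d - ((j : ℕ) + 1) := by omega
    have hq0 : (0 : ℝ) < Fintype.card K := by positivity
    have h3 : ((N : ℝ) + 2) ^ (d - ((j : ℕ) + 1)) ≤ ((N : ℝ) + 2) ^ (d - 1) :=
      pow_le_pow_right₀ (by linarith [(Nat.cast_nonneg N : (0 : ℝ) ≤ N)]) (by omega)
    have h4 : ((N + 1 : ℕ) : ℝ) * (Fintype.card K / 2) ≤ X * Fintype.card K :=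
      (mul_le_mul_of_nonneg_left (by linarith) (Nat.cast_nonneg _)).trans
        (h1.trans (mul_le_mul_of_nonneg_right h2 hq0.le))
    push_cast at h4
    have h5 : ((N : ℝ) + 1) * Fintype.card K ≤ 2 * X * Fintype.card K := by linarith
    exact absurd (le_of_mul_le_mul_right h5 hq0) hN.not_ge

theorem exists_isLRStable_weightedNorm_le (hd : 0 < d) (T : TensorForm K n (d + 1)) {ε : ℝ}
    (hε : 0 < ε) (hε1 : ε ≤ 1)
    (hq : 2 ^ d * (2 ^ (d + 1)) ^ (d - 1) * (analyticRank T + 1) ^ (d - 1) / ε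
      ≤ (Fintype.card K : ℝ)) :
    ∃ p : Fin d → Fin n → K, IsLRStable (toMap T) p ∧
      (weightedNorm (localRank (toMap T) p) : ℝ) ≤ ((2 : ℝ) ^ d - 1 + ε) * analyticRank T := by
  have hAR := analyticRank_nonneg T
  obtain ⟨p, hp⟩ := exists_sum_expRank_le hd T
  set a := analyticRank T
  set q : ℝ := (Fintype.card K : ℝ)
  have hq0 : 0 < q := by positivity
  obtain ⟨N, hN1, hN2⟩ : ∃ N : ℕ, (N : ℝ) ≤ 2 ^ (d + 1) * a ∧ 2 ^ (d + 1) * a < N + 1 :=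
    ⟨_, Nat.floor_le (by positivity), Nat.lt_floor_add_one _⟩
  have h2d : (2 : ℝ) ≤ 2 ^ d := by
    simpa using pow_le_pow_right₀ (one_le_two : (1 : ℝ) ≤ 2) hd
  have hB : 2 ^ d * ((N : ℝ) + 2) ^ (d - 1) ≤ ε * q := by
    have h1 : ((N : ℝ) + 2) ^ (d - 1) ≤ (2 ^ (d + 1) * (a + 1)) ^ (d - 1) := by
      refine pow_le_pow_left₀ (by positivity) ?_ _
      rw [pow_succ] at hN1 ⊢
      linarith
    rw [div_le_iff₀ hε, mul_comm q] at hq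
    rw [mul_pow] at h1
    refine le_trans ?_ hq
    rw [mul_assoc]
    exact mul_le_mul_of_nonneg_left h1 (by positivity)
  set B : ℝ := ((N : ℝ) + 2) ^ (d - 1) with hBdef
  have hB0 : 0 < B := by positivity
  have hB2 : 2 * B ≤ q := by nlinarith
  have hR := algLocalRank_le_of_expRank_le (toMap T) p (N := N)
    (expRank_le_of_sum_le (toMap T) p hp) (by rw [pow_succ] at hN2; linarith) hB2
  have hst : IsLRStable (toMap T) p :=
    isLRStable_of_pow_lt_card hd _ p hR (by linarith)
  refine ⟨p, hst, ?_⟩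
  rw [IsLRStable] at hst
  rw [hst]
  have h1 : ∀ j : Fin d, (ofColex (algLocalRank (toMap T) p) j : ℝ) * (q - B)
      ≤ expRank (toMap T) j (d - ((j : ℕ) + 1)) (by omega) p * q := fun j => by
    refine le_trans (mul_le_mul_of_nonneg_left (sub_le_sub_left ?_ _) (Nat.cast_nonneg _))
      (mul_sub_le_expRank_mul (toMap T) p (j := j) (by omega) (by omega) le_rfl
        ((hR j).trans (Nat.le_succ N)) fun i _ => hR i)
    exact pow_le_pow_right₀ (by linarith [(Nat.cast_nonneg N : (0 : ℝ) ≤ N)]) (by omega)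
  have h2 : (weightedNorm (algLocalRank (toMap T) p) : ℝ) * (q - B) ≤ (2 ^ d - 1) * a * q := by
    refine le_trans ?_ (mul_le_mul_of_nonneg_right hp hq0.le)
    rw [weightedNorm, Nat.cast_sum, Finset.sum_mul, Finset.sum_mul]
    refine Finset.sum_le_sum fun j _ => ?_
    push_cast
    rw [mul_assoc, mul_assoc]
    exact mul_le_mul_of_nonneg_left (h1 j) (by positivity)
  refine le_of_mul_le_mul_right (h2.trans ?_) (by linarith : 0 < q - B)
  -- As `ε ≤ 1`, the loss `(2 ^ d - 1 + ε) * B` is at most `2 ^ d * B`, hence at most `ε * q`.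
  have h3 : (2 ^ d - 1) * q ≤ (2 ^ d - 1 + ε) * (q - B) := by nlinarith
  nlinarith

end Main

end LocalRank

theorem mainTheorem3 (d : ℕ) (hd : 1 ≤ d) :
    ∃ C : ℝ, 0 < C ∧
      ∀ (F : Type*) [Field F] [Finite F] (n : ℕ) (T : LocalRank.TensorForm F n (d + 1)) (ε : ℝ),
        0 < ε → ε ≤ 1 →
        C * (LocalRank.analyticRank T + 1) ^ (d - 1) / ε ≤ (Nat.card F : ℝ) →
        ∃ p : Fin d → Fin n → F,
          LocalRank.IsLRStable (LocalRank.toMap T) p ∧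
          (LocalRank.weightedNorm (LocalRank.localRank (LocalRank.toMap T) p) : ℝ)
            ≤ ((2 : ℝ) ^ d - 1 + ε) * LocalRank.analyticRank T := by
  -- `N + 2` is at most `2 ^ (d + 1) * (AR + 1)`; the factor `2 ^ d` covers the loss in the final
  -- comparison.
  refine ⟨2 ^ d * (2 ^ (d + 1)) ^ (d - 1), by positivity, ?_⟩
  intro F _ _ n T ε hε hε1 hq
  classical
  cases nonempty_fintype F
  rw [Nat.card_eq_fintype_card] at hq
  exact LocalRank.exists_isLRStable_weightedNorm_le hd T hε hε1 hq
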